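/- Let $G$ be a countable discrete group acting on a (discrete) set $X$, and let $E \subseteq X$ be a non-empty subset. Let $G$ act on $\ell^\infty(X)$ by $(t.f)(x) = f(t^{-1}.x)$, let $\ell^\infty(X) \rtimes_r G$ be the reduced crossed product $C^*$-algebra, and let $1_E \in \ell^\infty(X) \subseteq \ell^\infty(X) \rtimes_r G$ be the indicator function of $E$. Then the following conditions are equivalent: (i) $E$ is $G$-paradoxical, i.e., there exist non-empty sets $V_1, \dots, V_{n+m} \subseteq X$ and elements $t_1, \dots, t_{n+m} \in G$ such that $\bigcup_{i=1}^n V_i = \bigcup_{i=n+1}^{n+m} V_i = E$ and such that $t_1.V_1, \dots, t_{n+m}.V_{n+m}$ are pairwise disjoint subsets of $E$. (ii) For every tracial weight $\varphi \colon (\ell^\infty(X) \rtimes_r G)^+ \to [0,\infty]$, the value $\varphi(1_E)$ is either $0$ or $\infty$. (iii) $1_E$ is properly infinite in $\ell^\infty(X) \rtimes_r G$. (iv) There is an integer $n \geq 1$ such that the $n$-fold direct sum $1_E \oplus 1_E \oplus \cdots \oplus 1_E$ is properly infinite in $M_n(\ell^\infty(X) \rtimes_r G)$. Here a tracial weight on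 a $C^*$-algebra $A$ is a map $\varphi \colon A^+ \to [0,\infty]$ with $\varphi(\alpha a + \beta b) = \alpha\varphi(a) + \beta\varphi(b)$ for all $a,b \in A^+$ and real $\alpha,\beta \geq 0$ (with the convention $0\cdot\infty = 0$), and $\varphi(x^*x) = \varphi(xx^*)$ for all $x \in A$; no lower semicontinuity is assumed. A positive element $a$ of a $C^*$-algebra $A$ is properly infinite if $a \neq 0$ and $a \oplus a \precsim a$, i.e., there is a sequence $(r_k)$ of $1 \times 2$ matrices over $A$ with $r_k^* a r_k \to \operatorname{diag}(a,a)$ in $M_2(A)$. -/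

import Mathlib

open Filter Topology
open scoped ENNReal NNReal Pointwise InnerProductSpace

/-! ### Paradoxical sets -/

/-- For a group `G` acting on `X` and a family `𝔼` of subsets of `X`, a non-empty set `U ⊆ X` is
`(G, 𝔼)`-paradoxical if there are non-empty `V₁, …, V_{n+m} ∈ 𝔼` and `t₁, …, t_{n+m} ∈ G` with
`⋃_{i ≤ n} V_i = ⋃_{n < i ≤ n+m} V_i = U` such that the `t_k.V_k` are pairwise disjoint subsets
of `U`. -/
def IsParadoxicalIn (G : Type*) {X : Type*} [Group G] [MulAction G X]
    (𝔼 : Set (Set X)) (U : Set X) : Prop :=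
  U.Nonempty ∧ ∃ (n m : ℕ) (V : Fin (n + m) → Set X) (t : Fin (n + m) → G),
    (∀ k, V k ∈ 𝔼 ∧ (V k).Nonempty) ∧
    (⋃ i : Fin n, V (Fin.castAdd m i)) = U ∧
    (⋃ j : Fin m, V (Fin.natAdd n j)) = U ∧
    (∀ k, t k • V k ⊆ U) ∧
    Pairwise fun k l => Disjoint (t k • V k) (t l • V l)

/-- A subset of a discrete `G`-set `X` is `G`-paradoxical if it is paradoxical with respect to the
family of all subsets of `X`. -/
def IsParadoxical (G : Type*) {X : Type*} [Group G] [MulAction G X] (U : Set X) : Prop :=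
  IsParadoxicalIn G (Set.univ : Set (Set X)) U

/-! ### Cuntz comparison, properly infinite elements and tracial weights -/

section CStar

variable {A : Type*} [NonUnitalCStarAlgebra A] [PartialOrder A] [StarOrderedRing A]

/-- Cuntz comparison `a ≾ b` of `a ∈ M_m(A)⁺` and `b ∈ M_n(A)⁺`: there is a sequence `r_k` of
`n × m` matrices over `A` with `r_k^* b r_k → a`. -/
def CuntzBelow {m n : Type*} [Fintype m] [Fintype n]
    (a : CStarMatrix m m A) (b : CStarMatrix n n A) : Prop :=
  ∃ r : ℕ → CStarMatrix n m A,
    Tendsto (fun k => (r k).conjTranspose * b * r k) atTop (𝓝 a)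

/-- The block diagonal matrix `a ⊕ b = diag(a, b)`. -/
def blockSum {m n : Type*} (a : CStarMatrix m m A) (b : CStarMatrix n n A) :
    CStarMatrix (m ⊕ n) (m ⊕ n) A :=
  CStarMatrix.ofMatrix
    (Matrix.fromBlocks (CStarMatrix.ofMatrix.symm a) 0 0 (CStarMatrix.ofMatrix.symm b))

/-- An element of `A` as a `1 × 1` matrix. -/
def oneByOne (a : A) : CStarMatrix (Fin 1) (Fin 1) A :=
  CStarMatrix.ofMatrix (Matrix.of fun _ _ => a)

/-- A positive element `a` of a C⋆-algebra is properly infinite if `a ≠ 0` and `a ⊕ a ≾ a`. -/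
def IsProperlyInfinite (a : A) : Prop :=
  0 ≤ a ∧ a ≠ 0 ∧ CuntzBelow (blockSum (oneByOne a) (oneByOne a)) (oneByOne a)

/-- The `n`-fold direct sum `a ⊕ a ⊕ ⋯ ⊕ a`, an element of the C⋆-algebra `M_n(A)`. -/
def nfoldSum (n : ℕ) (a : A) : CStarMatrix (Fin n) (Fin n) A :=
  CStarMatrix.ofMatrix (Matrix.diagonal fun _ => a)

variable (A) in
/-- A tracial weight on a C⋆-algebra `A`: an `ℝ⁺`-linear map `φ : A⁺ → [0, ∞]` with
`φ (x^* x) = φ (x x^*)` for all `x ∈ A`. No lower semicontinuity is required. -/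
structure TracialWeight where
  toFun : {a : A // 0 ≤ a} → ℝ≥0∞
  map_linear' : ∀ (s t : ℝ≥0) (a b : {a : A // 0 ≤ a}),
    toFun ⟨(s : ℝ) • (a : A) + (t : ℝ) • (b : A),
        add_nonneg (smul_nonneg s.2 a.2) (smul_nonneg t.2 b.2)⟩
      = (s : ℝ≥0∞) * toFun a + (t : ℝ≥0∞) * toFun b
  map_star_mul' : ∀ x : A,
    toFun ⟨star x * x, star_mul_self_nonneg x⟩ = toFun ⟨x * star x, mul_star_self_nonneg x⟩

end CStar

/-! ### The reduced crossed product by a discrete group -/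

section CrossedProduct

variable {G A H : Type*} [Group G] [CStarAlgebra A]
  [NormedAddCommGroup H] [InnerProductSpace ℂ H] [CompleteSpace H]

/-- The operator `(π_α(a) ξ)(t) = π(t⁻¹.a) ξ(t)` on `ℓ²(G, H)`. -/
noncomputable def regularOperator (α : G →* (A ≃⋆ₐ[ℂ] A)) (π : A →⋆ₐ[ℂ] (H →L[ℂ] H)) (a : A) :
    lp (fun _ : G => H) 2 →L[ℂ] lp (fun _ : G => H) 2 :=
  lp.mapCLM 2 (fun t : G => π (α t⁻¹ a)) (norm_nonneg a) fun t =>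
    (NonUnitalStarAlgHom.norm_apply_le π _).trans
      (NonUnitalStarAlgHom.norm_apply_le (α t⁻¹) a)

theorem regularOperator_apply (α : G →* (A ≃⋆ₐ[ℂ] A)) (π : A →⋆ₐ[ℂ] (H →L[ℂ] H)) (a : A)
    (ξ : lp (fun _ : G => H) 2) (t : G) :
    regularOperator α π a ξ t = π (α t⁻¹ a) (ξ t) := rfl

/-- The representation `π_α` of `A` on `ℓ²(G, H)`. -/
noncomputable def regularRep (α : G →* (A ≃⋆ₐ[ℂ] A)) (π : A →⋆ₐ[ℂ] (H →L[ℂ] H)) :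
    A →⋆ₐ[ℂ] (lp (fun _ : G => H) 2 →L[ℂ] lp (fun _ : G => H) 2) where
  toFun := regularOperator α π
  map_one' := by
    ext ξ t
    simp [regularOperator_apply]
  map_mul' a b := by
    ext ξ t
    simp [regularOperator_apply]
  map_zero' := by
    ext ξ t
    simp [regularOperator_apply]
  map_add' a b := by
    ext ξ t
    simp [regularOperator_apply]
  commutes' c := by
    ext ξ t
    rw [regularOperator_apply, Algebra.algebraMap_eq_smul_one, Algebra.algebraMap_eq_smul_one,
      map_smul, map_one, map_smul, map_one]
    rfl
  map_star' a := by
    rw [ContinuousLinearMap.star_eq_adjoint, ContinuousLinearMap.eq_adjoint_iff]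
    intro ξ η
    rw [lp.inner_eq_tsum, lp.inner_eq_tsum]
    refine tsum_congr fun t => ?_
    rw [regularOperator_apply, regularOperator_apply, map_star, map_star,
      ContinuousLinearMap.star_eq_adjoint, ContinuousLinearMap.adjoint_inner_left]

/-- The translation operator `(λ_s ξ)(t) = ξ(s⁻¹ t)` on `ℓ²(G, H)`. -/
noncomputable def regularTranslation (H : Type*) [NormedAddCommGroup H] [InnerProductSpace ℂ H]
    (s : G) : lp (fun _ : G => H) 2 →L[ℂ] lp (fun _ : G => H) 2 :=
  LinearMap.mkContinuous
    { toFun := fun ξ => ⟨fun t => ξ (s⁻¹ * t), by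
        have h := (lp.memℓp ξ).summable (by norm_num)
        exact memℓp_gen ((Equiv.mulLeft s⁻¹).summable_iff.mpr h)⟩
      map_add' := fun _ _ => rfl
      map_smul' := fun _ _ => rfl }
    1 fun ξ => by
      rw [one_mul, lp.norm_eq_tsum_rpow (by norm_num), lp.norm_eq_tsum_rpow (by norm_num)]
      exact le_of_eq (congrArg (· ^ _)
        ((Equiv.mulLeft s⁻¹).tsum_eq fun t => ‖ξ t‖ ^ (2 : ℝ≥0∞).toReal))

/-- The closed `*`-subalgebra of `B(ℓ²(G, H))` generated by `π_α(A)` and `λ(G)`. -/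
noncomputable def crossedProductSubalgebra (α : G →* (A ≃⋆ₐ[ℂ] A)) (π : A →⋆ₐ[ℂ] (H →L[ℂ] H)) :
    StarSubalgebra ℂ (lp (fun _ : G => H) 2 →L[ℂ] lp (fun _ : G => H) 2) :=
  (StarAlgebra.adjoin ℂ
    (Set.range (regularRep α π) ∪ Set.range (regularTranslation (G := G) H))).topologicalClosure

/-- The reduced crossed product C⋆-algebra `A ⋊_r G` of the action `α`, realised through the
regular representation attached to a faithful representation `π` of `A`. -/
def ReducedCrossedProduct (α : G →* (A ≃⋆ₐ[ℂ] A)) (π : A →⋆ₐ[ℂ] (H →L[ℂ] H)) : Type _ :=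
  crossedProductSubalgebra α π

namespace ReducedCrossedProduct

variable (α : G →* (A ≃⋆ₐ[ℂ] A)) (π : A →⋆ₐ[ℂ] (H →L[ℂ] H))

noncomputable instance : CStarAlgebra (ReducedCrossedProduct α π) :=
  haveI : IsClosed (crossedProductSubalgebra α π :
      Set (lp (fun _ : G => H) 2 →L[ℂ] lp (fun _ : G => H) 2)) :=
    StarSubalgebra.isClosed_topologicalClosure _
  StarSubalgebra.cstarAlgebra (crossedProductSubalgebra α π)

/-- The canonical inclusion `A → A ⋊_r G`. -/
noncomputable def incl : A →⋆ₐ[ℂ] ReducedCrossedProduct α π :=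
  (regularRep α π).codRestrict (crossedProductSubalgebra α π) fun a =>
    subset_closure (StarAlgebra.subset_adjoin ℂ _ (Or.inl ⟨a, rfl⟩))

end ReducedCrossedProduct

end CrossedProduct

/-! ### The algebra `ℓ^∞(X) ⋊_r G` -/

section Roe

/-- `ℓ^∞(X)`, the C⋆-algebra of bounded complex functions on `X`. -/
noncomputable abbrev EllInfty (X : Type*) := lp (fun _ : X => ℂ) ∞

/-- The action of `G` on `ℓ^∞(X)` by `(t.f)(x) = f(t⁻¹.x)`. -/
noncomputable def ellInftyAction (G X : Type*) [Group G] [MulAction G X] :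
    G →* (EllInfty X ≃⋆ₐ[ℂ] EllInfty X) where
  toFun t :=
    let T : G → EllInfty X → EllInfty X := fun s f =>
      ⟨fun x => f (s⁻¹ • x), memℓp_infty <| (lp.memℓp f).bddAbove.mono <| by
        rintro _ ⟨x, rfl⟩
        exact ⟨s⁻¹ • x, rfl⟩⟩
    { toFun := T t
      invFun := T t⁻¹
      left_inv := fun f => lp.ext <| funext fun x =>
        show f (t⁻¹ • (t⁻¹)⁻¹ • x) = f x by simp
      right_inv := fun f => lp.ext <| funext fun x =>
        show f ((t⁻¹)⁻¹ • t⁻¹ • x) = f x by simp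
      map_mul' := fun _ _ => rfl
      map_add' := fun _ _ => rfl
      map_star' := fun _ => rfl
      map_smul' := fun _ _ => rfl }
  map_one' := by
    ext f x
    change f ((1 : G)⁻¹ • x) = f x
    simp
  map_mul' s t := by
    ext f x
    change f ((s * t)⁻¹ • x) = f (t⁻¹ • s⁻¹ • x)
    rw [mul_inv_rev, mul_smul]

/-- The operator of multiplication by `f ∈ ℓ^∞(X)` on `ℓ²(X)`. -/
noncomputable def mulOperator {X : Type*} (f : EllInfty X) :
    lp (fun _ : X => ℂ) 2 →L[ℂ] lp (fun _ : X => ℂ) 2 :=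
  lp.mapCLM 2 (fun x => f x • ContinuousLinearMap.id ℂ ℂ) (norm_nonneg f) fun x => by
    simpa [norm_smul] using lp.norm_apply_le_norm ENNReal.top_ne_zero f x

theorem mulOperator_apply {X : Type*} (f : EllInfty X) (ξ : lp (fun _ : X => ℂ) 2) (x : X) :
    mulOperator f ξ x = f x * ξ x := rfl

/-- The representation of `ℓ^∞(X)` on `ℓ²(X)` by multiplication operators. -/
noncomputable def mulRep (X : Type*) :
    EllInfty X →⋆ₐ[ℂ] (lp (fun _ : X => ℂ) 2 →L[ℂ] lp (fun _ : X => ℂ) 2) where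
  toFun := mulOperator
  map_one' := by
    ext ξ x
    simp [mulOperator_apply]
  map_mul' f g := by
    ext ξ x
    simp [mulOperator_apply, mul_assoc]
  map_zero' := by
    ext ξ x
    simp [mulOperator_apply]
  map_add' f g := by
    ext ξ x
    simp [mulOperator_apply, add_mul]
  commutes' c := by
    ext ξ x
    rw [mulOperator_apply, Algebra.algebraMap_eq_smul_one, Algebra.algebraMap_eq_smul_one]
    simp
  map_star' f := by
    rw [ContinuousLinearMap.star_eq_adjoint, ContinuousLinearMap.eq_adjoint_iff]
    intro ξ η
    rw [lp.inner_eq_tsum, lp.inner_eq_tsum]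
    refine tsum_congr fun x => ?_
    simp only [mulOperator_apply, lp.coeFn_star, Pi.star_apply, RCLike.inner_apply, map_mul,
      RCLike.star_def, RCLike.conj_conj]
    ring

/-- The multiplication representation is faithful. -/
theorem mulRep_injective (X : Type*) : Function.Injective (mulRep X) := by
  classical
  intro f g h
  ext x
  have h1 := congrArg (fun T => T (lp.single 2 x (1 : ℂ)) x) h
  change f x * (lp.single 2 x (1 : ℂ) : lp (fun _ : X => ℂ) 2) x =
    g x * (lp.single 2 x (1 : ℂ) : lp (fun _ : X => ℂ) 2) x at h1
  simpa using h1

/-- The reduced crossed product `ℓ^∞(X) ⋊_r G`. -/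
def EllInftyCrossedProduct (G X : Type*) [Group G] [MulAction G X] : Type _ :=
  ReducedCrossedProduct (ellInftyAction G X) (mulRep X)

noncomputable instance (G X : Type*) [Group G] [MulAction G X] :
    CStarAlgebra (EllInftyCrossedProduct G X) :=
  inferInstanceAs (CStarAlgebra (ReducedCrossedProduct (ellInftyAction G X) (mulRep X)))

/-- The usual order of a C⋆-algebra: `a ≤ b` iff `b - a` is positive. -/
noncomputable instance (G X : Type*) [Group G] [MulAction G X] :
    PartialOrder (EllInftyCrossedProduct G X) :=
  CStarAlgebra.spectralOrder _

instance (G X : Type*) [Group G] [MulAction G X] :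
    StarOrderedRing (EllInftyCrossedProduct G X) :=
  CStarAlgebra.spectralOrderedRing _

/-- The indicator function of `E` in `ℓ^∞(X)`. -/
noncomputable def ellInftyIndicator {X : Type*} (E : Set X) : EllInfty X :=
  ⟨E.indicator 1, memℓp_infty ⟨1, by
    rintro _ ⟨x, rfl⟩
    by_cases h : x ∈ E <;> simp [h]⟩⟩

/-- The canonical inclusion `ℓ^∞(X) → ℓ^∞(X) ⋊_r G`. -/
noncomputable def ellInftyIncl (G X : Type*) [Group G] [MulAction G X] :
    EllInfty X →⋆ₐ[ℂ] EllInftyCrossedProduct G X :=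
  ReducedCrossedProduct.incl (ellInftyAction G X) (mulRep X)

/-- The projection `1_E` in `ℓ^∞(X) ⋊_r G`. -/
noncomputable def indicatorProj (G : Type*) {X : Type*} [Group G] [MulAction G X] (E : Set X) :
    EllInftyCrossedProduct G X :=
  ellInftyIncl G X (ellInftyIndicator E)

theorem indicatorProj_nonneg (G : Type*) {X : Type*} [Group G] [MulAction G X] (E : Set X) :
    0 ≤ indicatorProj G E := by
  have h : indicatorProj G E = star (indicatorProj G E) * indicatorProj G E := by
    rw [indicatorProj, ← map_star, ← map_mul]
    congr 1
    ext x
    by_cases hx : x ∈ E <;> simp [ellInftyIndicator, lp.infty_coeFn_mul, hx]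
  rw [h]
  exact star_mul_self_nonneg _

end Roe

/-!
The four conditions are proved equivalent in a cycle.

*Paradoxical sets give isometries.* A paradoxical decomposition of `E` amounts to two maps `E → E`,
injective and with disjoint ranges, that move each point by one of finitely many group elements
(`HasDoubling`). Summing the operators `u_k 1_{A k}`, where `A k` is the set on which such a map acts
by `k`, turns them into two partial isometries with initial projection `1_E` and orthogonal ranges
below `1_E`, so `1_E` is properly infinite (`HasDoubling.isProperlyInfinite`).

*Properly infinite direct sums leave only the values `0` and `∞`.* A tracial weight `φ` extends to
matrices by summing over the diagonal. If a projection `p` is properly infinite, there are `x, y` in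
the corner of `p` with `x^* x ≈ p ≈ y^* y` and `x^* y ≈ 0`. Then `x x^* + y y^*` is close to being a
projection, hence bounded by a multiple of `p` with factor close to `1`, while the trace property
gives it about the weight `2 φ(p)`. This forces `φ(p) ∈ {0, ∞}`
(`TracialWeight.eq_zero_or_eq_top`).

*A set that is not paradoxical has a tracial weight with a value in between.* If `E` cannot be
doubled, Hall's marriage theorem provides, for each finite `K ⊆ G`, a finite non-empty `F K ⊆ E` with
`|(K • F K) ∩ E| < 2 |F K|`. For a finite `T ⊆ G` and `f : X → [0, ∞]`, let `φ_T(f)` be the limit,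
along an ultrafilter on the finite subsets `K` of `G`, of `|F K|⁻¹ ∑_{y ∈ T • F K} f y`. The family
`φ_T` increases with `T`, so its supremum is additive; it is `G`-invariant because translating `f`
only replaces `T` by a translate; it is lower semicontinuous for uniform convergence because `φ_T`
changes by at most `|T| ε` when `f` changes by `ε`; and its value at `1_E` lies between `1` and `2`
(`exists_isInvariantIntegral_of_not_hasDoubling`). Composing it with the canonical conditional
expectation onto `ℓ^∞(X)` gives a weight. With the coefficients `c_g y = ⟨x δ_{1, y}, δ_{g, y}⟩`, the
expectation of `x^* x` is the uniformly convergent series `∑_g |c_g|²`, and that of `x x^*` is the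
series of the translates of the same terms, so the weight is tracial
(`IsInvariantIntegral.map_expectation_comm`).
-/

/-! ### Tracial weights and properly infinite projections -/

namespace TracialWeight

section Basic

variable {A : Type*} [NonUnitalCStarAlgebra A] [PartialOrder A] [StarOrderedRing A]
  (φ : TracialWeight A)

theorem map_add (a b : {a : A // 0 ≤ a}) : φ.toFun (a + b) = φ.toFun a + φ.toFun b := by
  have h := φ.map_linear' 1 1 a b
  simp only [NNReal.coe_one, one_smul, ENNReal.coe_one, one_mul] at h
  exact h

theorem map_zero : φ.toFun 0 = 0 := by
  have h := φ.map_linear' 0 0 0 0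
  simp only [NNReal.coe_zero, zero_smul, ENNReal.coe_zero, zero_mul, add_zero] at h
  exact h

/-- The additive map underlying a tracial weight. -/
noncomputable def toAddMonoidHom : {a : A // 0 ≤ a} →+ ℝ≥0∞ where
  toFun := φ.toFun
  map_zero' := φ.map_zero
  map_add' := φ.map_add

theorem map_smul (s : ℝ≥0) {a : A} (ha : 0 ≤ a) :
    φ.toFun ⟨(s : ℝ) • a, smul_nonneg s.2 ha⟩ = s * φ.toFun ⟨a, ha⟩ := by
  have h := φ.map_linear' s 0 ⟨a, ha⟩ 0
  simp only [NNReal.coe_zero, zero_smul, ENNReal.coe_zero, zero_mul, add_zero] at h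
  exact h

theorem mono {a b : A} (ha : 0 ≤ a) (hab : a ≤ b) :
    φ.toFun ⟨a, ha⟩ ≤ φ.toFun ⟨b, ha.trans hab⟩ := by
  have h : (⟨b, ha.trans hab⟩ : {a : A // 0 ≤ a}) = ⟨a, ha⟩ + ⟨b - a, sub_nonneg.mpr hab⟩ :=
    Subtype.ext (by simp)
  rw [h, map_add]
  exact le_self_add

theorem toFun_sum {ι : Type*} (s : Finset ι) (f : ι → A) (hf : ∀ i, 0 ≤ f i) :
    φ.toFun ⟨∑ i ∈ s, f i, Finset.sum_nonneg fun i _ => hf i⟩ =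
      ∑ i ∈ s, φ.toFun ⟨f i, hf i⟩ := by
  rw [show (⟨∑ i ∈ s, f i, Finset.sum_nonneg fun i _ => hf i⟩ : {a : A // 0 ≤ a}) =
    ∑ i ∈ s, ⟨f i, hf i⟩ from Subtype.ext
      (map_sum (Nonneg.coeAddMonoidHom (α := A)) (fun i => ⟨f i, hf i⟩) s).symm]
  exact map_sum φ.toAddMonoidHom _ s

end Basic

end TracialWeight

section MatrixWeight

variable {A : Type*} [NonUnitalCStarAlgebra A] {n : Type*} [Fintype n]

theorem CStarMatrix.diag_star_mul_self (x : CStarMatrix n n A) (i : n) :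
    (star x * x) i i = ∑ j, star (x j i) * x j i := by
  simp [CStarMatrix.mul_apply, CStarMatrix.star_apply]

variable [PartialOrder A] [StarOrderedRing A]

theorem CStarMatrix.diag_nonneg {x : CStarMatrix n n A} (hx : 0 ≤ x) (i : n) : 0 ≤ x i i := by
  rw [StarOrderedRing.nonneg_iff] at hx
  induction hx using AddSubmonoid.closure_induction with
  | mem x hx =>
    obtain ⟨y, rfl⟩ := hx
    change 0 ≤ (star y * y) i i
    rw [CStarMatrix.diag_star_mul_self]
    exact Finset.sum_nonneg fun j _ => star_mul_self_nonneg _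
  | zero => exact le_rfl
  | add x y _ _ hx hy => exact add_nonneg hx hy

/-- The tracial weight `x ↦ ∑ i, φ (x i i)` on matrices induced by a tracial weight `φ`. -/
noncomputable def TracialWeight.matrix (φ : TracialWeight A) (n : Type*) [Fintype n] :
    TracialWeight (CStarMatrix n n A) where
  toFun x := ∑ i, φ.toFun ⟨x.1 i i, CStarMatrix.diag_nonneg x.2 i⟩
  map_linear' s t a b := by
    rw [Finset.mul_sum, Finset.mul_sum, ← Finset.sum_add_distrib]
    exact Finset.sum_congr rfl fun i _ => φ.map_linear' s t ⟨_, _⟩ ⟨_, _⟩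
  map_star_mul' x := by
    have h1 (i : n) : φ.toFun ⟨(star x * x) i i, CStarMatrix.diag_nonneg (star_mul_self_nonneg x) i⟩
        = ∑ j, φ.toFun ⟨star (x j i) * x j i, star_mul_self_nonneg _⟩ := by
      rw [← φ.toFun_sum]
      simp only [CStarMatrix.diag_star_mul_self]
    have h2 (i : n) : φ.toFun ⟨(x * star x) i i, CStarMatrix.diag_nonneg (mul_star_self_nonneg x) i⟩
        = ∑ j, φ.toFun ⟨x i j * star (x i j), mul_star_self_nonneg _⟩ := by
      rw [← φ.toFun_sum]
      rfl
    simp only [h1, h2, φ.map_star_mul']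
    exact Finset.sum_comm

theorem TracialWeight.matrix_toFun (φ : TracialWeight A)
    (x : {x : CStarMatrix n n A // 0 ≤ x}) :
    (φ.matrix n).toFun x = ∑ i, φ.toFun ⟨x.1 i i, CStarMatrix.diag_nonneg x.2 i⟩ :=
  rfl

end MatrixWeight

section Corner

variable {M : Type*} [CStarAlgebra M]

/-- If `x^* x ≈ p`, `y^* y ≈ p` and `x^* y ≈ 0`, then `q = x x^* + y y^*` is self-adjoint with
`q² ≈ q`, which bounds its norm by about `1`. -/
theorem norm_range_sum_le {p x y : M} (hx : x * p = x) (hy : y * p = y) {ε : ℝ}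
    (hxx : ‖star x * x - p‖ ≤ ε) (hyy : ‖star y * y - p‖ ≤ ε) (hxy : ‖star x * y‖ ≤ ε)
    (hxn : ‖x‖ ≤ 2) (hyn : ‖y‖ ≤ 2) :
    ‖x * star x + y * star y‖ ≤ 1 + 16 * ε := by
  set q := x * star x + y * star y with hq
  have hε : 0 ≤ ε := (norm_nonneg _).trans hxy
  have hqs : star q = q := by simp [hq]
  have hyx : ‖star y * x‖ ≤ ε := by
    rw [← norm_star]; simpa using hxy
  have key : q * q = q + (x * (star x * x - p) * star x + x * (star x * y) * star y
      + y * (star y * x) * star x + y * (star y * y - p) * star y) := by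
    simp only [hq, mul_sub, sub_mul, hx, hy]
    noncomm_ring
  have tri (u v w : M) (hu : ‖u‖ ≤ 2) (hv : ‖v‖ ≤ ε) (hw : ‖w‖ ≤ 2) :
      ‖u * v * star w‖ ≤ 4 * ε := by
    calc ‖u * v * star w‖ ≤ ‖u‖ * ‖v‖ * ‖w‖ := by
          refine (norm_mul_le _ _).trans ?_
          rw [norm_star]
          gcongr
          exact norm_mul_le _ _
      _ ≤ 2 * ε * 2 := by gcongr
      _ = 4 * ε := by ring
  have hbound : ‖q‖ * ‖q‖ ≤ ‖q‖ + 16 * ε := by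
    calc ‖q‖ * ‖q‖ = ‖q * q‖ := by
          rw [← CStarRing.norm_star_mul_self (x := q), hqs]
      _ ≤ ‖q‖ + (4 * ε + 4 * ε + 4 * ε + 4 * ε) := by
          rw [key]
          refine (norm_add_le _ _).trans (add_le_add le_rfl ?_)
          refine (norm_add_le _ _).trans (add_le_add ?_ (tri _ _ _ hyn hyy hyn))
          refine (norm_add_le _ _).trans (add_le_add ?_ (tri _ _ _ hyn hyx hxn))
          exact (norm_add_le _ _).trans (add_le_add (tri _ _ _ hxn hxx hxn) (tri _ _ _ hxn hxy hyn))
      _ = ‖q‖ + 16 * ε := by ring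
  by_contra! hlt
  nlinarith [norm_nonneg q]

variable [PartialOrder M] [StarOrderedRing M]

/-- A self-adjoint element of the corner `pMp` is at most its norm times `p`. -/
theorem IsStarProjection.le_norm_smul {p a : M} (hp : IsStarProjection p) (ha : IsSelfAdjoint a)
    (hpa : p * a * p = a) : a ≤ ‖a‖ • p := by
  have h := star_left_conjugate_le_conjugate (IsSelfAdjoint.le_algebraMap_norm_self (a := a)) p
  rw [hp.isSelfAdjoint.star_eq, hpa, Algebra.algebraMap_eq_smul_one, mul_smul_comm, mul_one,
    smul_mul_assoc, hp.isIdempotentElem.eq] at h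
  exact h

/-- A tracial weight takes only the values `0` and `∞` at a properly infinite projection: if the
value is finite, then comparing the weight of `x^* x + y^* y ≈ 2p` with that of
`x x^* + y y^* ≲ p` forces it to vanish. -/
theorem TracialWeight.eq_zero_or_eq_top (φ : TracialWeight M) {p : M} (hp : IsStarProjection p)
    (h : IsProperlyInfinite p) (hp0 : 0 ≤ p) : φ.toFun ⟨p, hp0⟩ = 0 ∨ φ.toFun ⟨p, hp0⟩ = ∞ := by
  obtain ⟨-, -, r, hr⟩ := h
  have hps : star p = p := hp.isSelfAdjoint
  have hpp : p * p = p := hp.isIdempotentElem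
  -- entrywise form of the convergence `r_k^* p r_k → diag(p, p)`, with the entries of `r_k`
  -- compressed to the corner of `p`
  have entry (i j : Fin 1 ⊕ Fin 1) : Tendsto (fun k => star (p * r k 0 i * p) * (p * r k 0 j * p))
      atTop (𝓝 (p * blockSum (oneByOne p) (oneByOne p) i j * p)) := by
    have h1 : Tendsto (fun k => ((r k).conjTranspose * oneByOne p * r k) i j) atTop
        (𝓝 (blockSum (oneByOne p) (oneByOne p) i j)) :=
      ((continuous_apply_apply i j).tendsto _).comp hr
    refine ((h1.const_mul p).mul_const p).congr fun k => ?_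
    simp only [CStarMatrix.mul_apply, CStarMatrix.conjTranspose_apply, oneByOne,
      CStarMatrix.ofMatrix_apply, Matrix.of_apply, Fin.sum_univ_one, star_mul, hps]
    simp only [mul_assoc]
    rw [← mul_assoc p p, hpp]
  set x : ℕ → M := fun k => p * r k 0 (Sum.inl 0) * p with hx
  set y : ℕ → M := fun k => p * r k 0 (Sum.inr 0) * p with hy
  have hxx : Tendsto (fun k => star (x k) * x k) atTop (𝓝 p) := by
    simpa [-star_mul, blockSum, oneByOne, hpp] using entry (Sum.inl 0) (Sum.inl 0)
  have hyy : Tendsto (fun k => star (y k) * y k) atTop (𝓝 p) := by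
    simpa [-star_mul, blockSum, oneByOne, hpp] using entry (Sum.inr 0) (Sum.inr 0)
  have hxy : Tendsto (fun k => star (x k) * y k) atTop (𝓝 0) := by
    simpa [-star_mul, blockSum, oneByOne, hpp] using entry (Sum.inl 0) (Sum.inr 0)
  have hxp (k) : x k * p = x k := by simp only [hx, mul_assoc, hpp]
  have hyp (k) : y k * p = y k := by simp only [hy, mul_assoc, hpp]
  have hpx (k) : p * x k = x k := by simp only [hx, ← mul_assoc, hpp]
  have hpy (k) : p * y k = y k := by simp only [hy, ← mul_assoc, hpp]
  -- with `ε = 1 / 32`, the norm bound `1 + 16 * ε` becomes `3 / 2`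
  obtain ⟨k, hk1, hk2, hk3⟩ := ((hxx.eventually (Metric.closedBall_mem_nhds p
    (by norm_num : (0 : ℝ) < 1 / 32))).and ((hyy.eventually (Metric.closedBall_mem_nhds p
    (by norm_num : (0 : ℝ) < 1 / 32))).and (hxy.eventually (Metric.closedBall_mem_nhds 0
    (by norm_num : (0 : ℝ) < 1 / 32))))).exists
  rw [dist_eq_norm] at hk1 hk2 hk3
  rw [sub_zero] at hk3
  have hpn : ‖p‖ ≤ 1 := hp.norm_le
  have norm_le (z : M) (hz : ‖star z * z - p‖ ≤ 1 / 32) : ‖z‖ ≤ 2 := by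
    have h1 : ‖z‖ * ‖z‖ ≤ 1 + 1 / 32 := by
      rw [← CStarRing.norm_star_mul_self]
      calc ‖star z * z‖ = ‖p + (star z * z - p)‖ := by rw [add_sub_cancel]
        _ ≤ _ := (norm_add_le _ _).trans (add_le_add hpn hz)
    nlinarith [norm_nonneg z]
  have hq := norm_range_sum_le (hxp k) (hyp k) hk1 hk2 hk3 (norm_le _ hk1) (norm_le _ hk2)
  have upper : x k * star (x k) + y k * star (y k) ≤ ((3 / 2 : ℝ≥0) : ℝ) • p := by
    refine (hp.le_norm_smul (a := x k * star (x k) + y k * star (y k)) (by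
      simp [isSelfAdjoint_iff]) ?_).trans (smul_le_smul_of_nonneg_right (hq.trans ?_) hp0)
    · have h1 : star (x k) * p = star (x k) := by simpa [hps] using congrArg star (hpx k)
      have h2 : star (y k) * p = star (y k) := by simpa [hps] using congrArg star (hpy k)
      simp only [mul_add, add_mul, ← mul_assoc, hpx, hpy]
      simp only [mul_assoc, h1, h2]
    · norm_num
  have lower (z : M) (hzp : z * p = z) (hz : ‖star z * z - p‖ ≤ 1 / 32) :
      ((7 / 8 : ℝ≥0) : ℝ) • p ≤ star z * z := by
    have h1 : p * star z = star z := by simpa [hps] using congrArg star hzp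
    have h2 := hp.le_norm_smul (a := p - star z * z) (by simp [isSelfAdjoint_iff, hps]) (by
      simp only [mul_sub, sub_mul, hpp, ← mul_assoc, h1]
      simp only [mul_assoc, hzp])
    have h3 : p - star z * z ≤ (1 / 32 : ℝ) • p :=
      h2.trans (smul_le_smul_of_nonneg_right (by rwa [norm_sub_rev]) hp0)
    have h4 : ((7 / 8 : ℝ≥0) : ℝ) • p ≤ p - (1 / 32 : ℝ) • p := by
      rw [← sub_nonneg, show p - (1 / 32 : ℝ) • p - ((7 / 8 : ℝ≥0) : ℝ) • p = (3 / 32 : ℝ) • p by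
        push_cast; module]
      exact smul_nonneg (by norm_num) hp0
    exact h4.trans (sub_le_comm.mp h3)
  generalize hcdef : φ.toFun ⟨p, hp0⟩ = c
  have hX : (7 / 8 : ℝ≥0) * c ≤ φ.toFun ⟨x k * star (x k), mul_star_self_nonneg _⟩ := by
    rw [← φ.map_star_mul', ← hcdef, ← φ.map_smul]
    exact φ.mono _ (lower _ (hxp k) hk1)
  have hY : (7 / 8 : ℝ≥0) * c ≤ φ.toFun ⟨y k * star (y k), mul_star_self_nonneg _⟩ := by
    rw [← φ.map_star_mul', ← hcdef, ← φ.map_smul]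
    exact φ.mono _ (lower _ (hyp k) hk2)
  -- the two lower bounds add up to `7 / 4`, which exceeds the upper bound `3 / 2`
  have hXY : (7 / 8 : ℝ≥0) * c + (7 / 8 : ℝ≥0) * c ≤ (3 / 2 : ℝ≥0) * c := by
    refine (add_le_add hX hY).trans ?_
    rw [← φ.map_add, ← hcdef, ← φ.map_smul]
    exact φ.mono _ upper
  by_cases hc : c = ∞
  · exact Or.inr hc
  left
  clear hcdef hX hY
  lift c to ℝ≥0 using hc
  norm_cast at hXY ⊢
  rw [← NNReal.coe_le_coe] at hXY
  push_cast at hXY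
  exact le_antisymm (NNReal.coe_le_coe.mp (by push_cast; linarith)) zero_le

end Corner

/-! ### Direct sums of a projection -/

section NFold

variable {A : Type*} [CStarAlgebra A]

theorem nfoldSum_mul (n : ℕ) (x y : A) : nfoldSum n x * nfoldSum n y = nfoldSum n (x * y) :=
  Matrix.diagonal_mul_diagonal (fun _ : Fin n => x) fun _ => y

theorem star_nfoldSum (n : ℕ) (x : A) : star (nfoldSum n x) = nfoldSum n (star x) :=
  Matrix.diagonal_conjTranspose fun _ : Fin n => x

theorem isStarProjection_nfoldSum (n : ℕ) {p : A} (hp : IsStarProjection p) :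
    IsStarProjection (nfoldSum n p) :=
  ⟨(nfoldSum_mul n p p).trans (congrArg _ hp.isIdempotentElem),
    (star_nfoldSum n p).trans (congrArg _ hp.isSelfAdjoint)⟩

variable [PartialOrder A]

/-- Two partial isometries with initial projection `p` and orthogonal ranges below `p` witness that
`p` is properly infinite. -/
theorem isProperlyInfinite_of_isometries {p a b : A} (h0 : 0 ≤ p) (hne : p ≠ 0)
    (ha : star a * a = p) (hb : star b * b = p) (hab : star a * b = 0)
    (hpa : p * a = a) (hpb : p * b = b) : IsProperlyInfinite p := by
  have hba : star b * a = 0 := by simpa using congrArg star hab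
  refine ⟨h0, hne, fun _ => CStarMatrix.ofMatrix fun _ => Sum.elim (fun _ => a) fun _ => b, ?_⟩
  refine tendsto_const_nhds.congr fun _ => ?_
  ext i j
  simp only [CStarMatrix.mul_apply, CStarMatrix.conjTranspose_apply, Fin.sum_univ_one, mul_assoc]
  rcases i with i | i <;> rcases j with j | j
  · exact (ha.symm.trans (congrArg _ hpa.symm))
  · exact (hab.symm.trans (congrArg _ hpb.symm))
  · exact (hba.symm.trans (congrArg _ hpa.symm))
  · exact (hb.symm.trans (congrArg _ hpb.symm))

variable [StarOrderedRing A]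

theorem TracialWeight.eq_zero_or_eq_top_of_nfoldSum (φ : TracialWeight A) {p : A}
    (hp : IsStarProjection p) (hp0 : 0 ≤ p) {n : ℕ} (hn : 1 ≤ n)
    (h : IsProperlyInfinite (nfoldSum n p)) :
    φ.toFun ⟨p, hp0⟩ = 0 ∨ φ.toFun ⟨p, hp0⟩ = ∞ := by
  have hP : (φ.matrix (Fin n)).toFun ⟨nfoldSum n p, h.1⟩ = n * φ.toFun ⟨p, hp0⟩ := by
    have h1 (i : Fin n) : φ.toFun ⟨nfoldSum n p i i, CStarMatrix.diag_nonneg h.1 i⟩ =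
        φ.toFun ⟨p, hp0⟩ :=
      congrArg φ.toFun (Subtype.ext (Matrix.diagonal_apply_eq _ i))
    rw [φ.matrix_toFun, Finset.sum_congr rfl fun i _ => h1 i]
    simp
  have hn0 : (n : ℝ≥0∞) ≠ 0 := by exact_mod_cast (by omega : n ≠ 0)
  rcases (φ.matrix (Fin n)).eq_zero_or_eq_top (isStarProjection_nfoldSum n hp) h h.1 with h0 | h0
  · rw [hP, mul_eq_zero] at h0
    exact Or.inl (h0.resolve_left hn0)
  · rw [hP] at h0
    by_contra! hc
    exact ENNReal.mul_ne_top (ENNReal.natCast_ne_top n) hc.2 h0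

/-- The `1 × 1` matrices over a C⋆-algebra are a copy of it, so proper infiniteness passes from `a`
to the onefold direct sum of `a`. -/
theorem IsProperlyInfinite.nfoldSum_one {a : A} (h : IsProperlyInfinite a) :
    IsProperlyInfinite (nfoldSum 1 a) := by
  obtain ⟨h0, hne, r, hr⟩ := h
  refine ⟨?_, fun h => hne ?_, fun k => CStarMatrix.ofMatrix fun i j => nfoldSum 1 (r k i j), ?_⟩
  · obtain ⟨y, rfl⟩ := CStarAlgebra.nonneg_iff_eq_star_mul_self.mp h0
    rw [← nfoldSum_mul, ← star_nfoldSum]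
    exact star_mul_self_nonneg _
  · have h1 := congrArg (fun M : CStarMatrix (Fin 1) (Fin 1) A => M 0 0) h
    exact h1
  · have hcont : Continuous (nfoldSum 1 : A → CStarMatrix (Fin 1) (Fin 1) A) :=
      Continuous.matrix_diagonal (continuous_pi fun _ => continuous_id)
    refine tendsto_pi_nhds.mpr fun i => tendsto_pi_nhds.mpr fun j => ?_
    have h1 : Tendsto (fun k => ((r k).conjTranspose * oneByOne a * r k) i j) atTop
        (𝓝 (blockSum (oneByOne a) (oneByOne a) i j)) :=
      ((continuous_apply_apply i j).tendsto _).comp hr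
    have h2 := (hcont.tendsto _).comp h1
    have h3 : nfoldSum 1 (blockSum (oneByOne a) (oneByOne a) i j) =
        blockSum (oneByOne (nfoldSum 1 a)) (oneByOne (nfoldSum 1 a)) i j := by
      have hz : nfoldSum 1 (0 : A) = 0 := Matrix.diagonal_zero
      rcases i with i | i <;> rcases j with j | j
      · rfl
      · exact hz
      · exact hz
      · rfl
    rw [h3] at h2
    refine h2.congr fun k => ?_
    simp only [Function.comp_apply, CStarMatrix.mul_apply, CStarMatrix.conjTranspose_apply,
      oneByOne, CStarMatrix.ofMatrix_apply, Matrix.of_apply, Fin.sum_univ_one]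
    rw [← nfoldSum_mul, ← nfoldSum_mul, ← star_nfoldSum]
    rfl

end NFold

/-! ### Paradoxical sets and Hall's theorem -/

section Paradoxical

variable {G X : Type*} [Group G] [MulAction G X]

/-- `E` can be mapped injectively into itself twice, with disjoint ranges, by moving each point with
one of finitely many group elements: `x ↦ σ i x • x` for `i : Bool` are the two maps. -/
def HasDoubling (G : Type*) {X : Type*} [Group G] [MulAction G X] (E : Set X) : Prop :=
  ∃ (K : Finset G) (σ : Bool → X → G), (∀ i, ∀ x ∈ E, σ i x ∈ K) ∧
    (∀ i, ∀ x ∈ E, σ i x • x ∈ E) ∧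
    ∀ i j, ∀ x ∈ E, ∀ y ∈ E, σ i x • x = σ j y • y → i = j ∧ x = y

theorem IsParadoxical.hasDoubling {E : Set X} (h : IsParadoxical G E) : HasDoubling G E := by
  classical
  obtain ⟨hne, n, m, V, t, -, hn, hm, hE, hd⟩ := h
  have hex (i : Bool) (x : X) : ∃ k : Fin (n + m), x ∈ E → x ∈ V k ∧ ((k : ℕ) < n ↔ i = true) := by
    by_cases hx : x ∈ E
    · cases i
      · obtain ⟨j, hj⟩ := Set.mem_iUnion.mp (hm ▸ hx)
        exact ⟨Fin.natAdd n j, fun _ => ⟨hj, by simp⟩⟩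
      · obtain ⟨j, hj⟩ := Set.mem_iUnion.mp (hn ▸ hx)
        exact ⟨Fin.castAdd m j, fun _ => ⟨hj, by simp⟩⟩
    · obtain ⟨x₀, hx₀⟩ := hne
      obtain ⟨j, -⟩ := Set.mem_iUnion.mp (hn ▸ hx₀)
      exact ⟨Fin.castAdd m j, fun h => absurd h hx⟩
  choose κ hκ using hex
  refine ⟨Finset.univ.image t, fun i x => t (κ i x), fun i x _ => by simp, fun i x hx =>
    hE _ (Set.smul_mem_smul_set (hκ i x hx).1), fun i j x hx y hy hxy => ?_⟩
  have hk : κ i x = κ j y := by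
    by_contra hne
    exact Set.disjoint_left.mp (hd hne) (Set.smul_mem_smul_set (hκ i x hx).1)
      (hxy ▸ Set.smul_mem_smul_set (hκ j y hy).1)
  refine ⟨?_, ?_⟩
  · have h1 := (hκ i x hx).2
    rw [hk, (hκ j y hy).2] at h1
    exact (Bool.eq_iff_iff.mpr h1).symm
  · exact MulAction.injective (t (κ i x)) (by simpa only [hk] using hxy)

theorem HasDoubling.isParadoxical {E : Set X} (hE : E.Nonempty) (h : HasDoubling G E) :
    IsParadoxical G E := by
  classical
  obtain ⟨K, σ, hK, hσ, hinj⟩ := h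
  let L (i : Bool) : Finset G := K.filter fun g => ∃ x ∈ E, σ i x = g
  let ind : Fin ((L false).card + (L true).card) → Bool × G :=
    Fin.append (fun a => (false, ((L false).equivFin.symm a : G)))
      (fun b => (true, ((L true).equivFin.symm b : G)))
  have hind : Function.Injective ind := by
    intro k l
    refine Fin.addCases (fun a => ?_) (fun b => ?_) k <;>
      refine Fin.addCases (fun a' => ?_) (fun b' => ?_) l <;>
      simp [ind]
  have hmem (k) : (ind k).2 ∈ L (ind k).1 := by
    refine Fin.addCases (fun a => ?_) (fun b => ?_) k
    · simpa only [ind, Fin.append_left] using ((L false).equivFin.symm a).2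
    · simpa only [ind, Fin.append_right] using ((L true).equivFin.symm b).2
  refine ⟨hE, _, _, fun k => {x ∈ E | σ (ind k).1 x = (ind k).2}, fun k => (ind k).2,
    fun k => ⟨Set.mem_univ _, ?_⟩, ?_, ?_, ?_, ?_⟩
  · obtain ⟨x, hx, h⟩ := (Finset.mem_filter.mp (hmem k)).2
    exact ⟨x, hx, h⟩
  · ext x
    simp only [Set.mem_iUnion, Set.mem_ofPred_eq, exists_and_left, and_iff_left_iff_imp]
    intro hx
    refine ⟨(L false).equivFin ⟨σ false x, Finset.mem_filter.mpr ⟨hK _ x hx, x, hx, rfl⟩⟩, ?_⟩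
    simp [ind]
  · ext x
    simp only [Set.mem_iUnion, Set.mem_ofPred_eq, exists_and_left, and_iff_left_iff_imp]
    intro hx
    refine ⟨(L true).equivFin ⟨σ true x, Finset.mem_filter.mpr ⟨hK _ x hx, x, hx, rfl⟩⟩, ?_⟩
    simp [ind]
  · rintro k _ ⟨x, ⟨hx, hk⟩, rfl⟩
    simpa only [← hk] using hσ _ x hx
  · intro k l hkl
    refine Set.disjoint_left.mpr ?_
    rintro _ ⟨x, ⟨hx, hk⟩, rfl⟩ ⟨y, ⟨hy, hl⟩, hxy⟩
    obtain ⟨h1, rfl⟩ := hinj _ _ y hy x hx (by rw [hk, hl]; exact hxy)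
    exact hkl (hind (Prod.ext h1.symm (by rw [← hk, ← hl, h1])))

/-- Hall's marriage theorem for the bipartite graph between `E × Bool` and `E` in which `(x, i)` is
joined to the points of `K • x`: if it has no matching, some finite set grows by a factor of less
than two. -/
theorem exists_finset_card_lt_of_not_hasDoubling [DecidableEq X] {E : Set X} [DecidablePred (· ∈ E)]
    (h : ¬ HasDoubling G E) (K : Finset G) :
    ∃ F : Finset X, F.Nonempty ∧ (∀ x ∈ F, x ∈ E) ∧
      ((K • F).filter (· ∈ E)).card < 2 * F.card := by
  by_contra! hF
  let t : E × Bool → Finset X := fun p => (K • ({p.1.1} : Finset X)).filter (· ∈ E)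
  obtain ⟨f, hf, hft⟩ := (Finset.all_card_le_biUnion_card_iff_exists_injective t).mp fun s => by
    set F := s.image fun p => (p.1 : X) with hFdef
    have h1 : s.card ≤ 2 * F.card := by
      have h2 : s.card ≤ (F ×ˢ (Finset.univ : Finset Bool)).card :=
        Finset.card_le_card_of_injOn (fun p => (p.1.1, p.2))
          (fun p hp => by
            simp only [Finset.coe_product, Finset.coe_univ, Set.mem_prod, Set.mem_univ, and_true]
            exact Finset.mem_image_of_mem _ hp)
          (fun p _ q _ hpq => by
            simp only [Prod.mk.injEq] at hpq
            exact Prod.ext (Subtype.ext hpq.1) hpq.2)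
      rw [Finset.card_product] at h2
      simpa [mul_comm] using h2
    rcases F.eq_empty_or_nonempty with h0 | hne
    · rw [h0] at h1
      exact h1.trans (by simp)
    refine h1.trans ((hF F hne ?_).trans (Finset.card_le_card fun y hy => ?_))
    · intro x hx
      obtain ⟨p, -, rfl⟩ := Finset.mem_image.mp hx
      exact p.1.2
    · obtain ⟨hy, hyE⟩ := Finset.mem_filter.mp hy
      obtain ⟨k, hk, x, hx, rfl⟩ := Finset.mem_smul.mp hy
      obtain ⟨p, hp, rfl⟩ := Finset.mem_image.mp hx
      exact Finset.mem_biUnion.mpr ⟨p, hp, Finset.mem_filter.mpr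
        ⟨Finset.smul_mem_smul hk (Finset.mem_singleton_self _), hyE⟩⟩
  have hex (i : Bool) (x : X) : ∃ g : G, ∀ hx : x ∈ E, g ∈ K ∧ g • x = f (⟨x, hx⟩, i) := by
    by_cases hx : x ∈ E
    · obtain ⟨g, hg, y, hy, hgy⟩ := Finset.mem_smul.mp (Finset.mem_filter.mp (hft (⟨x, hx⟩, i))).1
      rw [Finset.mem_singleton] at hy
      exact ⟨g, fun _ => ⟨hg, by rw [← hgy, hy]⟩⟩
    · exact ⟨1, fun h => absurd h hx⟩
  choose σ hσ using hex
  refine h ⟨K, σ, fun i x hx => (hσ i x hx).1, fun i x hx => ?_, fun i j x hx y hy hxy => ?_⟩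
  · rw [(hσ i x hx).2]
    exact (Finset.mem_filter.mp (hft (⟨x, hx⟩, i))).2
  · rw [(hσ i x hx).2, (hσ j y hy).2] at hxy
    have h1 := hf hxy
    simp only [Prod.mk.injEq, Subtype.mk.injEq] at h1
    exact ⟨h1.2, h1.1⟩

end Paradoxical

/-! ### An invariant integral -/

section Integral

variable {G X : Type*} [Group G] [MulAction G X]

/-- A `[0, ∞]`-valued integral of non-negative functions on `X`: it is additive, homogeneous,
`G`-invariant, and lower semicontinuous for uniform convergence. -/
structure IsInvariantIntegral (G : Type*) {X : Type*} [Group G] [MulAction G X]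
    (I : (X → ℝ≥0∞) → ℝ≥0∞) : Prop where
  map_add : ∀ f g, I (f + g) = I f + I g
  map_smul : ∀ (c : ℝ≥0) f, I (fun y => c * f y) = c * I f
  map_translate : ∀ (g : G) f, I (fun y => f (g • y)) = I f
  le_of_forall_pos : ∀ f b, (∀ ε : ℝ≥0, 0 < ε → ∃ h, I h ≤ b ∧ ∀ y, f y ≤ h y + ε) → I f ≤ b

theorem IsInvariantIntegral.mono {I : (X → ℝ≥0∞) → ℝ≥0∞} (hI : IsInvariantIntegral G I)
    {f g : X → ℝ≥0∞} (hfg : f ≤ g) : I f ≤ I g :=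
  hI.le_of_forall_pos f _ fun _ _ => ⟨g, le_rfl, fun y => (hfg y).trans le_self_add⟩

theorem IsInvariantIntegral.map_zero {I : (X → ℝ≥0∞) → ℝ≥0∞} (hI : IsInvariantIntegral G I) :
    I 0 = 0 := by
  have h := hI.map_smul 0 0
  simpa [← Pi.zero_def] using h

theorem IsInvariantIntegral.map_sum {I : (X → ℝ≥0∞) → ℝ≥0∞} (hI : IsInvariantIntegral G I)
    {ι : Type*} (s : Finset ι) (f : ι → X → ℝ≥0∞) : I (∑ i ∈ s, f i) = ∑ i ∈ s, I (f i) := by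
  classical
  induction s using Finset.induction_on with
  | empty => simpa using hI.map_zero
  | insert a s ha ih => rw [Finset.sum_insert ha, Finset.sum_insert ha, hI.map_add, ih]

/-- Lower semicontinuity lets the integral be exchanged with a series that converges uniformly. -/
theorem IsInvariantIntegral.map_tsum {I : (X → ℝ≥0∞) → ℝ≥0∞} (hI : IsInvariantIntegral G I)
    {ι : Type*} (f : ι → X → ℝ≥0∞)
    (hf : ∀ ε : ℝ≥0, 0 < ε → ∃ s : Finset ι, ∀ y, ∑' i, f i y ≤ ∑ i ∈ s, f i y + ε) :
    I (fun y => ∑' i, f i y) = ∑' i, I (f i) := by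
  refine le_antisymm (hI.le_of_forall_pos _ _ fun ε hε => ?_) ?_
  · obtain ⟨s, hs⟩ := hf ε hε
    refine ⟨∑ i ∈ s, f i, ?_, fun y => by simpa using hs y⟩
    rw [hI.map_sum]
    exact ENNReal.sum_le_tsum s
  · rw [ENNReal.tsum_eq_iSup_sum]
    refine iSup_le fun s => ?_
    rw [← hI.map_sum]
    exact hI.mono fun y => by simpa using ENNReal.sum_le_tsum s

section Average

variable [DecidableEq X]

/-- The limit along the ultrafilter `U` of the sums of `f` over the thickened sets `T • F K`,
normalised by the cardinality of `F K`. -/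
noncomputable def limitAverage (F : Finset G → Finset X) (U : Ultrafilter (Finset G))
    (T : Finset G) (f : X → ℝ≥0∞) : ℝ≥0∞ :=
  (U.map fun K => (∑ y ∈ T • F K, f y) / (F K).card).lim

variable (F : Finset G → Finset X) (U : Ultrafilter (Finset G))

theorem tendsto_limitAverage (T : Finset G) (f : X → ℝ≥0∞) :
    Tendsto (fun K => (∑ y ∈ T • F K, f y) / (F K).card) U (𝓝 (limitAverage F U T f)) :=
  (U.map fun K => (∑ y ∈ T • F K, f y) / ((F K).card : ℝ≥0∞)).le_nhds_lim

theorem limitAverage_mono {T T' : Finset G} (hT : T ⊆ T') {f f' : X → ℝ≥0∞} (hf : f ≤ f') :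
    limitAverage F U T f ≤ limitAverage F U T' f' := by
  refine le_of_tendsto_of_tendsto' (tendsto_limitAverage F U T f) (tendsto_limitAverage F U T' f')
    fun K => ENNReal.div_le_div_right ?_ _
  exact (Finset.sum_le_sum fun y _ => hf y).trans
    (Finset.sum_le_sum_of_subset (Finset.smul_subset_smul_right hT))

theorem limitAverage_add (T : Finset G) (f f' : X → ℝ≥0∞) :
    limitAverage F U T (f + f') = limitAverage F U T f + limitAverage F U T f' := by
  refine tendsto_nhds_unique (tendsto_limitAverage F U T (f + f'))
    (((tendsto_limitAverage F U T f).add (tendsto_limitAverage F U T f')).congr fun K => ?_)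
  simp only [Pi.add_apply, Finset.sum_add_distrib, ENNReal.add_div]

theorem limitAverage_smul (T : Finset G) (c : ℝ≥0) (f : X → ℝ≥0∞) :
    limitAverage F U T (fun y => c * f y) = c * limitAverage F U T f := by
  refine tendsto_nhds_unique (tendsto_limitAverage F U T fun y => c * f y)
    ((ENNReal.Tendsto.const_mul (tendsto_limitAverage F U T f)
      (Or.inr ENNReal.coe_ne_top)).congr fun K => ?_)
  rw [← Finset.mul_sum, mul_div_assoc]

theorem limitAverage_const_le (T : Finset G) (c : ℝ≥0∞) :
    limitAverage F U T (fun _ => c) ≤ T.card * c := by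
  refine le_of_tendsto' (tendsto_limitAverage F U T fun _ => c) fun K => ?_
  refine ENNReal.div_le_of_le_mul ?_
  rw [Finset.sum_const, nsmul_eq_mul, mul_right_comm]
  gcongr
  exact_mod_cast Finset.card_image₂_le (· • ·) T (F K)

theorem limitAverage_translate [DecidableEq G] (T : Finset G) (g : G) (f : X → ℝ≥0∞) :
    limitAverage F U T (fun y => f (g • y)) = limitAverage F U (g • T) f := by
  refine tendsto_nhds_unique (tendsto_limitAverage F U T fun y => f (g • y))
    ((tendsto_limitAverage F U (g • T) f).congr fun K => ?_)
  rw [smul_assoc, Finset.smul_finset_def, Finset.sum_image (MulAction.injective g).injOn]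

theorem isInvariantIntegral_iSup_limitAverage :
    IsInvariantIntegral G fun f => ⨆ T, limitAverage F U T f where
  map_add f f' := by
    classical
    simp only [limitAverage_add]
    exact (ENNReal.iSup_add_iSup_of_monotone (fun T T' h => limitAverage_mono F U h le_rfl)
      fun T T' h => limitAverage_mono F U h le_rfl).symm
  map_smul c f := by
    simp only [limitAverage_smul, ENNReal.mul_iSup]
  map_translate g f := by
    classical
    simp only [limitAverage_translate]
    exact (MulAction.toPerm g : Equiv.Perm (Finset G)).iSup_comp
      (g := fun T => limitAverage F U T f)
  le_of_forall_pos f b h := by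
    refine iSup_le fun T => ENNReal.le_of_forall_pos_le_add fun ε hε _ => ?_
    obtain ⟨h, hb, hf⟩ := h (ε / (T.card + 1)) (by positivity)
    calc limitAverage F U T f
        ≤ limitAverage F U T (h + fun _ => ((ε / (T.card + 1) : ℝ≥0) : ℝ≥0∞)) :=
          limitAverage_mono F U subset_rfl hf
      _ ≤ b + T.card * ((ε / (T.card + 1) : ℝ≥0) : ℝ≥0∞) := by
          rw [limitAverage_add]
          exact add_le_add ((le_iSup (fun T => limitAverage F U T h) T).trans hb)
            (limitAverage_const_le F U T _)
      _ ≤ b + ε := by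
          gcongr
          norm_cast
          rw [mul_div_assoc', div_le_iff₀ (by positivity), mul_comm]
          gcongr
          exact le_self_add

end Average

/-- If no finite set of translations doubles `E`, some invariant integral is finite and non-zero at
`E`: the sets `F K` produced by Hall's theorem satisfy
`F K ⊆ E` and `|(K • F K) ∩ E| < 2 |F K|`, so the normalised sum of the indicator function of `E`
over `T • F K` is `1` for `T = {1}` and at most `2` whenever `T ⊆ K`. -/
theorem exists_isInvariantIntegral_of_not_hasDoubling {E : Set X} (h : ¬ HasDoubling G E) :
    ∃ I : (X → ℝ≥0∞) → ℝ≥0∞, IsInvariantIntegral G I ∧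
      I (E.indicator 1) ≠ 0 ∧ I (E.indicator 1) ≠ ∞ := by
  classical
  choose F hne hFE hF using exists_finset_card_lt_of_not_hasDoubling h
  let U : Ultrafilter (Finset G) := Ultrafilter.of atTop
  have hU : (U : Filter (Finset G)) ≤ atTop := Ultrafilter.of_le _
  have hsum (s : Finset X) :
      ∑ y ∈ s, E.indicator (1 : X → ℝ≥0∞) y = ((s.filter (· ∈ E)).card : ℝ≥0∞) := by
    rw [Finset.card_filter]
    push_cast
    exact Finset.sum_congr rfl fun y _ => by by_cases hy : y ∈ E <;> simp [hy]
  refine ⟨_, isInvariantIntegral_iSup_limitAverage F U, ?_, ?_⟩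
  · refine (lt_of_lt_of_le zero_lt_one (le_trans ?_
      (le_iSup (fun T => limitAverage F U T (E.indicator 1)) 1))).ne'
    refine ge_of_tendsto' (tendsto_limitAverage F U 1 (E.indicator 1)) fun K => ?_
    have h1 : (F K).filter (· ∈ E) = F K := Finset.filter_true_of_mem (hFE K)
    rw [one_smul, hsum, h1, ENNReal.div_self]
    · exact_mod_cast (hne K).card_ne_zero
    · exact ENNReal.natCast_ne_top _
  · have hle (T : Finset G) : limitAverage F U T (E.indicator 1) ≤ 2 := by
      refine le_of_tendsto (tendsto_limitAverage F U T (E.indicator 1))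
        (mem_of_superset (hU (Ici_mem_atTop T)) fun K (hK : T ⊆ K) => ?_)
      refine ENNReal.div_le_of_le_mul ?_
      rw [hsum]
      exact_mod_cast (Finset.card_le_card (Finset.filter_subset_filter _
        (Finset.smul_subset_smul_right hK))).trans (hF K).le
    exact ((iSup_le hle).trans_lt (by norm_num)).ne

end Integral

/-! ### Generators of the crossed product -/

section Generators

variable {G X : Type*} [Group G]

/-- The Hilbert space `ℓ²(G, ℓ²(X))` on which `ℓ^∞(X) ⋊_r G` acts. -/
noncomputable abbrev EllTwoRegular (G X : Type*) := lp (fun _ : G => lp (fun _ : X => ℂ) 2) 2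

theorem regularTranslation_apply (g : G) (ξ : EllTwoRegular G X) (t : G) :
    regularTranslation (lp (fun _ : X => ℂ) 2) g ξ t = ξ (g⁻¹ * t) :=
  rfl

variable (G X) in
/-- The unitary representation `g ↦ λ_g` of `G` on `ℓ²(G, ℓ²(X))`, as a monoid homomorphism. -/
noncomputable def translationHom : G →* (EllTwoRegular G X →L[ℂ] EllTwoRegular G X) where
  toFun g := regularTranslation _ g
  map_one' := by
    ext ξ t z
    simp [regularTranslation_apply]
  map_mul' g h := by
    ext ξ t z
    simp [regularTranslation_apply, mul_assoc]

theorem translationHom_apply (g : G) (ξ : EllTwoRegular G X) (t : G) :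
    translationHom G X g ξ t = ξ (g⁻¹ * t) :=
  rfl

theorem star_translationHom (g : G) : star (translationHom G X g) = translationHom G X g⁻¹ := by
  rw [ContinuousLinearMap.star_eq_adjoint, eq_comm, ContinuousLinearMap.eq_adjoint_iff]
  intro ξ η
  rw [lp.inner_eq_tsum, lp.inner_eq_tsum, ← (Equiv.mulLeft g⁻¹).tsum_eq]
  refine tsum_congr fun t => ?_
  simp [translationHom_apply]

variable [MulAction G X]

theorem regularRep_mulRep_apply (f : EllInfty X) (ξ : EllTwoRegular G X) (t : G) (z : X) :
    regularRep (ellInftyAction G X) (mulRep X) f ξ t z = f (t • z) * ξ t z := by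
  change f ((t⁻¹)⁻¹ • z) * ξ t z = _
  rw [inv_inv]

theorem ellInftyAction_apply (g : G) (f : EllInfty X) (z : X) :
    ellInftyAction G X g f z = f (g⁻¹ • z) :=
  rfl

/-- The covariance relation `λ_g f = (g.f) λ_g`. -/
theorem translationHom_mul_regularRep (g : G) (f : EllInfty X) :
    translationHom G X g * regularRep (ellInftyAction G X) (mulRep X) f =
      regularRep (ellInftyAction G X) (mulRep X) (ellInftyAction G X g f) *
        translationHom G X g := by
  ext ξ t z
  simp [translationHom_apply, regularRep_mulRep_apply, ellInftyAction_apply, mul_smul]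

variable (G X) in
/-- The operators `f λ_g` with `f ∈ ℓ^∞(X)` and `g ∈ G`; they form a monoid because of the
covariance relation. -/
noncomputable def monomialOperators : Submonoid (EllTwoRegular G X →L[ℂ] EllTwoRegular G X) where
  carrier := {x | ∃ (f : EllInfty X) (g : G),
    x = regularRep (ellInftyAction G X) (mulRep X) f * translationHom G X g}
  one_mem' := ⟨1, 1, by simp⟩
  mul_mem' := by
    rintro _ _ ⟨f, g, rfl⟩ ⟨f', g', rfl⟩
    refine ⟨f * ellInftyAction G X g f', g * g', ?_⟩
    rw [map_mul, map_mul, mul_assoc, ← mul_assoc (translationHom G X g),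
      translationHom_mul_regularRep]
    simp only [mul_assoc]

/-- The crossed product is the closed linear span of the operators `f λ_g`. -/
theorem crossedProductSubalgebra_subset_closure :
    (crossedProductSubalgebra (ellInftyAction G X) (mulRep X) :
      Set (EllTwoRegular G X →L[ℂ] EllTwoRegular G X)) ⊆
      closure (Submodule.span ℂ
        (monomialOperators G X : Set (EllTwoRegular G X →L[ℂ] EllTwoRegular G X)) : Set _) := by
  refine closure_mono ?_
  set S := Set.range (regularRep (ellInftyAction G X) (mulRep X)) ∪
    Set.range (regularTranslation (G := G) (lp (fun _ : X => ℂ) 2)) with hS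
  have hstar : star S ⊆ S := by
    intro x hx
    rw [Set.mem_star] at hx
    rcases hx with ⟨f, hf⟩ | ⟨g, hg⟩
    · exact Or.inl ⟨star f, by rw [map_star, hf, star_star]⟩
    · refine Or.inr ⟨g⁻¹, ?_⟩
      have h := star_translationHom (X := X) g
      rw [← star_star x, ← hg]
      exact h.symm
  have hmono : S ⊆ monomialOperators G X := by
    rintro _ (⟨f, rfl⟩ | ⟨g, rfl⟩)
    · exact ⟨f, 1, by simp⟩
    · refine ⟨1, g, ?_⟩
      rw [map_one, one_mul]
      rfl
  intro x hx
  have hx' : x ∈ Algebra.adjoin ℂ (S ∪ star S) := hx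
  rw [Set.union_eq_self_of_subset_right hstar, ← Subalgebra.mem_toSubmodule,
    Algebra.adjoin_eq_span] at hx'
  exact Submodule.span_mono (Submonoid.closure_le.mpr hmono) hx'

end Generators

/-! ### Matrix coefficients -/

section Coefficients

variable {G X : Type*} [DecidableEq X]

/-- If `ξ` is supported on `G × {y}`, then its norm is computed from the coordinates `ξ s y`. -/
theorem ofReal_norm_sq_eq_tsum {ξ : EllTwoRegular G X} {y : X} (h : ∀ s z, z ≠ y → ξ s z = 0) :
    ENNReal.ofReal (‖ξ‖ ^ 2) = ∑' s, ‖ξ s y‖ₑ ^ 2 := by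
  have hs (s : G) : ‖ξ s‖ = ‖ξ s y‖ := by
    have h1 : ξ s = lp.single 2 y (ξ s y) := by
      ext z
      by_cases hz : z = y
      · subst hz
        simp
      · simp [h s z hz, lp.single_apply, hz]
    rw [h1, lp.norm_single (by norm_num)]
    simp
  have h2 := lp.hasSum_norm (p := 2) (by norm_num) ξ
  simp only [ENNReal.toReal_ofNat, Real.rpow_two, hs] at h2
  rw [← h2.tsum_eq, ENNReal.ofReal_tsum_of_nonneg (fun _ => by positivity) h2.summable]
  refine tsum_congr fun s => ?_
  rw [ENNReal.ofReal_pow (norm_nonneg _), ofReal_norm]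

variable [DecidableEq G]

/-- The basis vector `δ_{t, y}` of `ℓ²(G, ℓ²(X))`. -/
noncomputable def basisVec (t : G) (y : X) : EllTwoRegular G X :=
  lp.single 2 t (lp.single 2 y (1 : ℂ))

theorem basisVec_apply (t s : G) (y z : X) :
    basisVec t y s z = if s = t ∧ z = y then 1 else 0 := by
  rw [basisVec]
  by_cases h : s = t
  · subst h
    by_cases h' : z = y <;> simp [h', lp.single_apply]
  · simp [h, lp.single_apply]

theorem norm_basisVec (t : G) (y : X) : ‖basisVec t y‖ = 1 := by
  rw [basisVec, lp.norm_single (by norm_num), lp.norm_single (by norm_num), norm_one]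

theorem inner_basisVec_left (s : G) (z : X) (ξ : EllTwoRegular G X) :
    inner ℂ (basisVec s z) ξ = ξ s z := by
  rw [basisVec, lp.inner_single_left, lp.inner_single_left]
  simp

/-- The matrix coefficient `⟨x δ_{t, y}, δ_{s, z}⟩` (linear in `x`) of an operator `x`. -/
noncomputable def matrixCoeff (t : G) (y : X) (s : G) (z : X) :
    (EllTwoRegular G X →L[ℂ] EllTwoRegular G X) →L[ℂ] ℂ :=
  (innerSL ℂ (basisVec s z)).comp (ContinuousLinearMap.apply ℂ _ (basisVec t y))

theorem matrixCoeff_apply (t : G) (y : X) (s : G) (z : X)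
    (x : EllTwoRegular G X →L[ℂ] EllTwoRegular G X) :
    matrixCoeff t y s z x = x (basisVec t y) s z :=
  inner_basisVec_left s z _

theorem matrixCoeff_star (t : G) (y : X) (s : G) (z : X)
    (x : EllTwoRegular G X →L[ℂ] EllTwoRegular G X) :
    matrixCoeff t y s z (star x) = star (matrixCoeff s z t y x) := by
  change inner ℂ (basisVec s z) (star x (basisVec t y)) =
    star (inner ℂ (basisVec t y) (x (basisVec s z)))
  rw [ContinuousLinearMap.star_eq_adjoint, ContinuousLinearMap.adjoint_inner_right,
    ← inner_conj_symm, RCLike.star_def]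

theorem matrixCoeff_star_mul_self (t : G) (y : X) (x : EllTwoRegular G X →L[ℂ] EllTwoRegular G X) :
    matrixCoeff t y t y (star x * x) = ((‖x (basisVec t y)‖ ^ 2 : ℝ) : ℂ) := by
  change inner ℂ (basisVec t y) (star x (x (basisVec t y))) = _
  rw [ContinuousLinearMap.star_eq_adjoint, ContinuousLinearMap.adjoint_inner_right,
    inner_self_eq_norm_sq_to_K]
  norm_cast

variable [Group G] [MulAction G X]

variable (G X) in
/-- The operators whose matrix coefficients satisfy the two identities valid in the crossed product:
`x δ_{t, y}` is supported on `G × {y}`, and the coefficients are invariant under the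
right translations `δ_{t, y} ↦ δ_{t r⁻¹, r y}`. -/
def bandOperators : Submodule ℂ (EllTwoRegular G X →L[ℂ] EllTwoRegular G X) where
  carrier := {x | ∀ t y s z, matrixCoeff t y s z x =
    if z = y then matrixCoeff 1 (t • y) (s * t⁻¹) (t • y) x else 0}
  zero_mem' := by simp
  add_mem' {x x'} hx hx' t y s z := by
    rw [map_add, hx, hx', map_add]
    split_ifs <;> simp
  smul_mem' c x hx t y s z := by
    rw [map_smul, hx, map_smul]
    split_ifs <;> simp

theorem isClosed_bandOperators :
    IsClosed (bandOperators G X : Set (EllTwoRegular G X →L[ℂ] EllTwoRegular G X)) := by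
  have h : (bandOperators G X : Set (EllTwoRegular G X →L[ℂ] EllTwoRegular G X)) =
      ⋂ (t) (y) (s) (z), {x | matrixCoeff t y s z x =
        if z = y then matrixCoeff 1 (t • y) (s * t⁻¹) (t • y) x else 0} := by
    ext x
    simp only [Set.mem_iInter]
    rfl
  rw [h]
  refine isClosed_iInter fun t => isClosed_iInter fun y => isClosed_iInter fun s =>
    isClosed_iInter fun z => isClosed_eq (matrixCoeff t y s z).continuous ?_
  split_ifs
  · exact (matrixCoeff _ _ _ _).continuous
  · exact continuous_const

theorem matrixCoeff_monomial (f : EllInfty X) (g : G) (t : G) (y : X) (s : G) (z : X) :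
    matrixCoeff t y s z
      (regularRep (ellInftyAction G X) (mulRep X) f * translationHom G X g) =
      if s = g * t ∧ z = y then f (s • z) else 0 := by
  rw [matrixCoeff_apply, mul_apply_eq_comp, regularRep_mulRep_apply,
    translationHom_apply, basisVec_apply, mul_ite, mul_one, mul_zero]
  simp only [inv_mul_eq_iff_eq_mul]

theorem span_monomialOperators_le_bandOperators :
    Submodule.span ℂ (monomialOperators G X : Set (EllTwoRegular G X →L[ℂ] EllTwoRegular G X)) ≤
      bandOperators G X := by
  refine Submodule.span_le.mpr ?_
  rintro _ ⟨f, g, rfl⟩ t y s z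
  simp only [matrixCoeff_monomial, mul_one, mul_inv_eq_iff_eq_mul, and_true]
  by_cases hz : z = y
  · subst hz
    simp [smul_smul]
  · simp [hz]

theorem crossedProductSubalgebra_subset_bandOperators :
    (crossedProductSubalgebra (ellInftyAction G X) (mulRep X) :
      Set (EllTwoRegular G X →L[ℂ] EllTwoRegular G X)) ⊆ bandOperators G X := by
  refine crossedProductSubalgebra_subset_closure.trans
    (closure_minimal span_monomialOperators_le_bandOperators isClosed_bandOperators)

theorem exists_finset_of_mem_span {x : EllTwoRegular G X →L[ℂ] EllTwoRegular G X}
    (hx : x ∈ Submodule.span ℂ (monomialOperators G X : Set (EllTwoRegular G X →L[ℂ] _))) :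
    ∃ S : Finset G, ∀ g ∉ S, ∀ y : X, matrixCoeff 1 y g y x = 0 := by
  induction hx using Submodule.span_induction with
  | mem x hx =>
    obtain ⟨f, g, rfl⟩ := hx
    refine ⟨{g}, fun s hs y => ?_⟩
    rw [matrixCoeff_monomial, if_neg]
    simpa using hs
  | zero => exact ⟨∅, by simp⟩
  | add x x' _ _ hx hx' =>
    obtain ⟨S, hS⟩ := hx
    obtain ⟨S', hS'⟩ := hx'
    refine ⟨S ∪ S', fun g hg y => ?_⟩
    rw [Finset.notMem_union] at hg
    rw [map_add, hS g hg.1, hS' g hg.2, add_zero]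
  | smul c x _ hx =>
    obtain ⟨S, hS⟩ := hx
    exact ⟨S, fun g hg y => by rw [map_smul, hS g hg, smul_zero]⟩

theorem ofReal_norm_sq_apply_basisVec {x : EllTwoRegular G X →L[ℂ] EllTwoRegular G X}
    (hx : x ∈ bandOperators G X) (y : X) :
    ENNReal.ofReal (‖x (basisVec 1 y)‖ ^ 2) = ∑' g, ‖matrixCoeff 1 y g y x‖ₑ ^ 2 := by
  simp only [matrixCoeff_apply]
  refine ofReal_norm_sq_eq_tsum fun s z hz => ?_
  rw [← matrixCoeff_apply, hx, if_neg hz]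

/-- For `x` in the crossed product, the series `∑_g |⟨x δ_{1, y}, δ_{g, y}⟩|²` converges uniformly
in `y`, since `x` is a norm limit of operators with finitely many non-zero terms. -/
theorem exists_finset_tsum_matrixCoeff_le {x : EllTwoRegular G X →L[ℂ] EllTwoRegular G X}
    (hx : x ∈ crossedProductSubalgebra (ellInftyAction G X) (mulRep X)) {ε : ℝ≥0} (hε : 0 < ε) :
    ∃ S : Finset G, ∀ y : X, ∑' g, ‖matrixCoeff 1 y g y x‖ₑ ^ 2 ≤
      ∑ g ∈ S, ‖matrixCoeff 1 y g y x‖ₑ ^ 2 + ε := by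
  obtain ⟨x', hx', hd⟩ := Metric.mem_closure_iff.mp (crossedProductSubalgebra_subset_closure hx)
    (NNReal.sqrt ε) (by simpa using hε)
  obtain ⟨S, hS⟩ := exists_finset_of_mem_span hx'
  have hband : x - x' ∈ bandOperators G X :=
    sub_mem (crossedProductSubalgebra_subset_bandOperators hx)
      (span_monomialOperators_le_bandOperators hx')
  refine ⟨S, fun y => ?_⟩
  calc ∑' g, ‖matrixCoeff 1 y g y x‖ₑ ^ 2
      ≤ ∑' g, ((if g ∈ S then ‖matrixCoeff 1 y g y x‖ₑ ^ 2 else 0) +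
          ‖matrixCoeff 1 y g y (x - x')‖ₑ ^ 2) := by
        refine ENNReal.tsum_le_tsum fun g => ?_
        by_cases hg : g ∈ S
        · simp [hg]
        · simp [hg, map_sub, hS g hg y]
    _ = ∑ g ∈ S, ‖matrixCoeff 1 y g y x‖ₑ ^ 2 +
          ENNReal.ofReal (‖(x - x') (basisVec 1 y)‖ ^ 2) := by
        rw [ENNReal.tsum_add, ofReal_norm_sq_apply_basisVec hband]
        congr 1
        rw [tsum_eq_sum (s := S) fun g hg => if_neg hg]
        exact Finset.sum_congr rfl fun g hg => if_pos hg
    _ ≤ ∑ g ∈ S, ‖matrixCoeff 1 y g y x‖ₑ ^ 2 + ε := by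
        gcongr
        refine ENNReal.ofReal_le_of_le_toReal ?_
        have h1 : ‖(x - x') (basisVec 1 y)‖ ≤ NNReal.sqrt ε := by
          refine ((x - x').le_opNorm _).trans ?_
          rw [norm_basisVec, mul_one, ← dist_eq_norm]
          exact hd.le
        calc ‖(x - x') (basisVec 1 y)‖ ^ 2 ≤ (NNReal.sqrt ε : ℝ) ^ 2 := by gcongr
          _ = (ε : ℝ) := by rw [← NNReal.coe_pow, NNReal.sq_sqrt]

end Coefficients

/-! ### Isometries in the crossed product of a paradoxical set -/

section Isometries

variable {G X : Type*}

theorem ellInftyIndicator_apply [DecidableEq X] (A : Set X) [DecidablePred (· ∈ A)] (x : X) :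
    ellInftyIndicator A x = if x ∈ A then 1 else 0 := by
  change A.indicator 1 x = _
  simp [Set.indicator_apply]

theorem ellInftyIndicator_mul (A B : Set X) :
    ellInftyIndicator A * ellInftyIndicator B = ellInftyIndicator (A ∩ B) := by
  classical
  ext x
  rw [lp.infty_coeFn_mul, Pi.mul_apply]
  simp only [ellInftyIndicator_apply, Set.mem_inter_iff]
  by_cases h : x ∈ A <;> simp [h]

theorem star_ellInftyIndicator (A : Set X) :
    star (ellInftyIndicator A) = ellInftyIndicator A := by
  classical
  ext x
  rw [lp.coeFn_star, Pi.star_apply]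
  simp only [ellInftyIndicator_apply]
  by_cases h : x ∈ A <;> simp [h]

theorem ellInftyIndicator_empty : ellInftyIndicator (∅ : Set X) = 0 := by
  classical
  ext x
  simp [ellInftyIndicator_apply]

theorem sum_ellInftyIndicator [DecidableEq G] {E : Set X} {K : Finset G} {σ : X → G}
    (hσ : ∀ x ∈ E, σ x ∈ K) :
    ∑ k ∈ K, ellInftyIndicator {x ∈ E | σ x = k} = ellInftyIndicator E := by
  classical
  ext x
  rw [lp.coeFn_sum, Finset.sum_apply]
  simp only [ellInftyIndicator_apply, Set.mem_ofPred_eq]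
  by_cases h : x ∈ E
  · simp [h, hσ x h]
  · simp [h]

variable [Group G] [MulAction G X]

theorem ellInftyAction_indicator (g : G) (A : Set X) :
    ellInftyAction G X g (ellInftyIndicator A) = ellInftyIndicator (g • A) := by
  classical
  ext x
  rw [ellInftyAction_apply]
  simp only [ellInftyIndicator_apply, Set.mem_smul_set_iff_inv_smul_mem]

variable (G) in
theorem indicatorProj_mul (A B : Set X) :
    indicatorProj G A * indicatorProj G B = indicatorProj G (A ∩ B) := by
  rw [indicatorProj, indicatorProj, ← map_mul, ellInftyIndicator_mul, indicatorProj]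

variable (G) in
theorem isStarProjection_indicatorProj (A : Set X) : IsStarProjection (indicatorProj G A) where
  isIdempotentElem := by rw [IsIdempotentElem, indicatorProj_mul, Set.inter_self]
  isSelfAdjoint := by
    rw [isSelfAdjoint_iff, indicatorProj, ← map_star, star_ellInftyIndicator]

variable (G X) in
/-- The inclusion of `ℓ^∞(X) ⋊_r G` into the bounded operators on `ℓ²(G, ℓ²(X))`. -/
noncomputable def toOperator :
    EllInftyCrossedProduct G X →⋆ₐ[ℂ] (EllTwoRegular G X →L[ℂ] EllTwoRegular G X) :=
  (crossedProductSubalgebra (ellInftyAction G X) (mulRep X)).subtype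

theorem toOperator_injective : Function.Injective (toOperator G X) :=
  Subtype.val_injective

theorem toOperator_mem (x : EllInftyCrossedProduct G X) :
    toOperator G X x ∈ crossedProductSubalgebra (ellInftyAction G X) (mulRep X) :=
  Subtype.prop (p := (· ∈ crossedProductSubalgebra (ellInftyAction G X) (mulRep X))) x

theorem toOperator_incl (f : EllInfty X) :
    toOperator G X (ellInftyIncl G X f) = regularRep (ellInftyAction G X) (mulRep X) f :=
  rfl

variable (X) in
/-- The canonical unitary `u_g` of the crossed product. -/
noncomputable def canonicalUnitary (g : G) : EllInftyCrossedProduct G X :=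
  (⟨translationHom G X g, subset_closure (StarAlgebra.subset_adjoin ℂ _ (Or.inr ⟨g, rfl⟩))⟩ :
    crossedProductSubalgebra (ellInftyAction G X) (mulRep X))

theorem toOperator_canonicalUnitary (g : G) :
    toOperator G X (canonicalUnitary X g) = translationHom G X g :=
  rfl

theorem star_canonicalUnitary (g : G) :
    star (canonicalUnitary X g) = canonicalUnitary X g⁻¹ :=
  toOperator_injective (by
    rw [map_star, toOperator_canonicalUnitary, toOperator_canonicalUnitary, star_translationHom])

theorem canonicalUnitary_mul (g h : G) :
    canonicalUnitary X g * canonicalUnitary X h = canonicalUnitary X (g * h) :=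
  toOperator_injective (by simp only [map_mul, toOperator_canonicalUnitary])

theorem canonicalUnitary_one : canonicalUnitary X (1 : G) = 1 :=
  toOperator_injective (by simp only [map_one, toOperator_canonicalUnitary])

theorem canonicalUnitary_mul_indicatorProj (g : G) (A : Set X) :
    canonicalUnitary X g * indicatorProj G A = indicatorProj G (g • A) * canonicalUnitary X g :=
  toOperator_injective (by
    rw [map_mul, map_mul, toOperator_canonicalUnitary, indicatorProj, indicatorProj,
      toOperator_incl, toOperator_incl, translationHom_mul_regularRep, ellInftyAction_indicator])

theorem indicatorProj_ne_zero {E : Set X} (hE : E.Nonempty) : indicatorProj G E ≠ 0 := by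
  classical
  intro h
  obtain ⟨x, hx⟩ := hE
  have h1 := matrixCoeff_monomial (G := G) (ellInftyIndicator E) 1 1 x 1 x
  rw [map_one, mul_one, ← toOperator_incl, ← indicatorProj, h, map_zero, map_zero,
    if_pos (by simp), ellInftyIndicator_apply, one_smul, if_pos hx] at h1
  exact zero_ne_one h1

/-- If `E` is doubled by the maps `x ↦ σ i x • x`, then the elements `∑_k u_k 1_{σ i x = k}` are
partial isometries with initial projection `1_E` and orthogonal ranges below `1_E`. -/
theorem HasDoubling.isProperlyInfinite {E : Set X} (hE : E.Nonempty) (h : HasDoubling G E) :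
    IsProperlyInfinite (indicatorProj G E) := by
  classical
  obtain ⟨K, σ, hK, hσ, hinj⟩ := h
  let A (i : Bool) (k : G) : Set X := {x ∈ E | σ i x = k}
  let a (i : Bool) : EllInftyCrossedProduct G X :=
    ∑ k ∈ K, canonicalUnitary X k * indicatorProj G (A i k)
  -- points of `A i k` and `A j l` are moved to the same place only if all the data agree
  have hA (i j : Bool) (k l : G) (h : ¬ (i = j ∧ k = l)) : A i k ∩ (k⁻¹ * l) • A j l = ∅ := by
    refine Set.eq_empty_of_forall_notMem ?_
    rintro x ⟨⟨hx, hxk⟩, y, ⟨hy, hyl⟩, hxy⟩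
    obtain ⟨h1, h2⟩ := hinj i j x hx y hy (by
      rw [hxk, hyl, ← hxy]
      simp [smul_smul])
    exact h ⟨h1, by rw [← hxk, ← hyl, h1, h2]⟩
  have hterm (i j : Bool) (k l : G) :
      star (canonicalUnitary X k * indicatorProj G (A i k)) *
        (canonicalUnitary X l * indicatorProj G (A j l)) =
      if i = j ∧ k = l then indicatorProj G (A i k) else 0 := by
    rw [star_mul, (isStarProjection_indicatorProj G _).isSelfAdjoint.star_eq,
      star_canonicalUnitary, mul_assoc, ← mul_assoc (canonicalUnitary X k⁻¹), canonicalUnitary_mul]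
    split_ifs with h
    · obtain ⟨rfl, rfl⟩ := h
      rw [inv_mul_cancel, canonicalUnitary_one, one_mul, indicatorProj_mul, Set.inter_self]
    · rw [canonicalUnitary_mul_indicatorProj, ← mul_assoc, indicatorProj_mul, hA i j k l h,
        indicatorProj, ellInftyIndicator_empty, map_zero, zero_mul]
  have hprod (i j : Bool) : star (a i) * a j = if i = j then indicatorProj G E else 0 := by
    simp only [a, star_sum, Finset.sum_mul_sum, hterm]
    split_ifs with h
    · simp only [h, true_and, Finset.sum_ite_eq, Finset.sum_ite_mem, Finset.inter_self]
      simp only [indicatorProj, ← map_sum]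
      rw [sum_ellInftyIndicator (hK j)]
    · simp [h]
  have hrange (i : Bool) : indicatorProj G E * a i = a i := by
    rw [Finset.mul_sum]
    refine Finset.sum_congr rfl fun k _ => ?_
    rw [canonicalUnitary_mul_indicatorProj, ← mul_assoc, indicatorProj_mul,
      Set.inter_eq_right.mpr]
    rintro _ ⟨x, ⟨hx, hxk⟩, rfl⟩
    simpa only [hxk] using hσ i x hx
  exact isProperlyInfinite_of_isometries (indicatorProj_nonneg G E) (indicatorProj_ne_zero hE)
    (by simpa using hprod false false) (by simpa using hprod true true)
    (by simpa using hprod false true) (hrange false) (hrange true)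

end Isometries

/-! ### The tracial weight of an invariant integral -/

section Weight

variable {G X : Type*} [Group G] [MulAction G X] [DecidableEq G] [DecidableEq X]

/-- The function `y ↦ ⟨a δ_{1, y}, δ_{1, y}⟩` on `X`, which is the value at `a ≥ 0` of the canonical
conditional expectation onto `ℓ^∞(X)`. -/
noncomputable def expectation (a : EllInftyCrossedProduct G X) (y : X) : ℝ≥0∞ :=
  ENNReal.ofReal (matrixCoeff 1 y 1 y (toOperator G X a)).re

theorem matrixCoeff_toOperator_re_nonneg {a : EllInftyCrossedProduct G X} (ha : 0 ≤ a) (y : X) :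
    0 ≤ (matrixCoeff 1 y 1 y (toOperator G X a)).re := by
  obtain ⟨b, rfl⟩ := CStarAlgebra.nonneg_iff_eq_star_mul_self.mp ha
  rw [map_mul, map_star, matrixCoeff_star_mul_self, Complex.ofReal_re]
  positivity

theorem expectation_star_mul_self (x : EllInftyCrossedProduct G X) (y : X) :
    expectation (star x * x) y = ∑' g, ‖matrixCoeff 1 y g y (toOperator G X x)‖ₑ ^ 2 := by
  rw [expectation, map_mul, map_star, matrixCoeff_star_mul_self, Complex.ofReal_re,
    ofReal_norm_sq_apply_basisVec
      (crossedProductSubalgebra_subset_bandOperators (toOperator_mem x))]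

theorem expectation_linear (s t : ℝ≥0) {a b : EllInftyCrossedProduct G X} (ha : 0 ≤ a)
    (hb : 0 ≤ b) : expectation ((s : ℝ) • a + (t : ℝ) • b) =
      (fun y => (s : ℝ≥0∞) * expectation a y) + fun y => (t : ℝ≥0∞) * expectation b y := by
  funext y
  have h (r : ℝ) (c : EllInftyCrossedProduct G X) : toOperator G X (r • c) =
      (r : ℂ) • toOperator G X c := by
    rw [← map_smul, Complex.coe_smul]
  rw [Pi.add_apply, expectation, map_add, map_add, h, h, map_smul, map_smul, Complex.add_re,
    smul_eq_mul, smul_eq_mul, Complex.re_ofReal_mul, Complex.re_ofReal_mul, ENNReal.ofReal_add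
      (mul_nonneg s.coe_nonneg (matrixCoeff_toOperator_re_nonneg ha y))
      (mul_nonneg t.coe_nonneg (matrixCoeff_toOperator_re_nonneg hb y)),
    ENNReal.ofReal_mul s.coe_nonneg, ENNReal.ofReal_mul t.coe_nonneg, ENNReal.ofReal_coe_nnreal,
    ENNReal.ofReal_coe_nnreal]
  rfl

theorem expectation_indicatorProj (E : Set X) :
    expectation (indicatorProj G E) = E.indicator 1 := by
  classical
  funext y
  have h1 := matrixCoeff_monomial (G := G) (ellInftyIndicator E) 1 1 y 1 y
  rw [map_one, mul_one, ← toOperator_incl, ← indicatorProj, if_pos (by simp), one_smul,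
    ellInftyIndicator_apply] at h1
  rw [expectation, h1]
  by_cases hy : y ∈ E <;> simp [hy]

variable {I : (X → ℝ≥0∞) → ℝ≥0∞}

theorem IsInvariantIntegral.map_expectation_star_mul_self (hI : IsInvariantIntegral G I)
    (x : EllInftyCrossedProduct G X) : I (expectation (star x * x)) =
      ∑' g, I fun y => ‖matrixCoeff 1 y g y (toOperator G X x)‖ₑ ^ 2 := by
  rw [← hI.map_tsum _ fun ε hε => exists_finset_tsum_matrixCoeff_le (toOperator_mem x) hε]
  exact congrArg I (funext (expectation_star_mul_self x))

/-- Passing from `x` to `x^*` moves the `g`-th term of the series to the place `g⁻¹` and translates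
it by a group element, which an invariant integral does not see. -/
theorem IsInvariantIntegral.map_expectation_comm (hI : IsInvariantIntegral G I)
    (x : EllInftyCrossedProduct G X) :
    I (expectation (star x * x)) = I (expectation (x * star x)) := by
  have h1 := hI.map_expectation_star_mul_self (star x)
  rw [star_star] at h1
  rw [hI.map_expectation_star_mul_self, h1, ← (Equiv.inv G).tsum_eq]
  refine tsum_congr fun g => ?_
  rw [← hI.map_translate g]
  refine congrArg I (funext fun y => ?_)
  rw [map_star, matrixCoeff_star,
    crossedProductSubalgebra_subset_bandOperators (toOperator_mem x) g y 1 y, if_pos rfl, one_mul,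
    Equiv.inv_apply, ← ofReal_norm (star _), norm_star, ofReal_norm]

/-- The tracial weight `a ↦ I (expectation a)`. -/
noncomputable def IsInvariantIntegral.tracialWeight (hI : IsInvariantIntegral G I) :
    TracialWeight (EllInftyCrossedProduct G X) where
  toFun a := I (expectation a.1)
  map_linear' s t a b := by
    rw [expectation_linear s t a.2 b.2, hI.map_add, hI.map_smul, hI.map_smul]
  map_star_mul' x := hI.map_expectation_comm x

end Weight

/-! ### The equivalence -/

theorem mainTheorem5 (G X : Type*) [Group G] [Countable G] [MulAction G X]
    (E : Set X) (hE : E.Nonempty) :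
    List.TFAE [
      IsParadoxical G E,
      ∀ φ : TracialWeight (EllInftyCrossedProduct G X),
        φ.toFun ⟨indicatorProj G E, indicatorProj_nonneg G E⟩ = 0 ∨
          φ.toFun ⟨indicatorProj G E, indicatorProj_nonneg G E⟩ = ∞,
      IsProperlyInfinite (indicatorProj G E),
      ∃ n : ℕ, 1 ≤ n ∧ IsProperlyInfinite (nfoldSum n (indicatorProj G E))] := by
  tfae_have 1 → 3 := fun h => h.hasDoubling.isProperlyInfinite hE
  tfae_have 3 → 4 := fun h => ⟨1, le_rfl, h.nfoldSum_one⟩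
  tfae_have 4 → 2 := fun ⟨_, hn, h⟩ φ =>
    φ.eq_zero_or_eq_top_of_nfoldSum (isStarProjection_indicatorProj G E) _ hn h
  tfae_have 2 → 1 := by
    classical
    intro h
    by_contra hnot
    obtain ⟨I, hI, h0, htop⟩ := exists_isInvariantIntegral_of_not_hasDoubling (G := G) (E := E)
      fun hd => hnot (hd.isParadoxical hE)
    rw [← expectation_indicatorProj (G := G)] at h0 htop
    exact (h hI.tracialWeight).elim h0 htop
  tfae_finish
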